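/- Let $d\ge 1$, let $\{|0\rangle,\dots,|d-1\rangle\}$ be the computational basis of $\mathbb{C}^d$, and for $\vec a=(a_1,a_2,a_3)\in\mathbb{Z}_d^3$ let $wt(\vec a)\in\{1,2,3\}$ be the number of equal values in $\vec a$, i.e. the largest multiplicity of a value among $a_1,a_2,a_3$. Put $$O_+=\sum_{\vec a\in\mathbb{Z}_d^3}\left[1+(-d)^{wt(\vec a)-1}\right]|\vec a\rangle\langle\vec a|,$$ an operator on $(\mathbb{C}^d)^{\otimes 3}$. Let $\mathcal{E}$ be a unitary $3$-design, i.e. a probability measure on $U(d)$ (for example the uniform measure on a finite set of unitaries) such that $\mathbb{E}_{U\sim\mathcal{E}}\,U^{\otimes 3}X(U^\dagger)^{\otimes 3}=\int_{\mathrm{Haar}}U^{\otimes 3}X(U^\dagger)^{\otimes 3}\,dU$ for every operator $X$ on $(\mathbb{C}^d)^{\otimes 3}$, and let $\Phi^3$ be the corresponding twirling map, $\Phi^3(X)=\mathbb{E}_{U\sim\mathcal{E}}\,U^{\otimes 3}X(U^\dagger)^{\otimes 3}$. Then for every state $\rho$ on $\mathbb{C}^d$ (positive semidefinite, $\mathrm{Tr}\,\rho=1$),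 $$\mathrm{Tr}\left[\Phi^3(O_+^2)\,\rho^{\otimes 3}\right]=\frac{1}{d+2}\left\{(d-1)(d^2+3d+4)+3d(d-1)(d+1)\,\mathrm{Tr}[\rho^2]+2(d^3-d^2+6)\,\mathrm{Tr}[\rho^3]\right\}.$$ The same equality holds if the twirling is taken with the opposite convention, $\Phi^3(X)=\mathbb{E}_{U\sim\mathcal{E}}\,(U^\dagger)^{\otimes 3}XU^{\otimes 3}$. -/

import Mathlib

open MeasureTheory
open scoped Matrix ComplexOrder

/-- The unitary group `U(d)` acting on the `d`-dimensional space `ℂ^d`. -/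
abbrev UGroup (d : ℕ) : Type := Matrix.unitaryGroup (Fin d) ℂ

noncomputable instance UGroup.instMeasurableSpace (d : ℕ) : MeasurableSpace (UGroup d) := borel _

instance UGroup.instBorelSpace (d : ℕ) : BorelSpace (UGroup d) := ⟨rfl⟩

instance UGroup.instCompactSpace (d : ℕ) : CompactSpace (UGroup d) := by
  have hclosed : IsClosed (Matrix.unitaryGroup (Fin d) ℂ : Set (Matrix (Fin d) (Fin d) ℂ)) :=
    isClosed_unitary
  have hK : IsCompact {A : Matrix (Fin d) (Fin d) ℂ |
      ∀ i, A i ∈ {v : Fin d → ℂ | ∀ j, v j ∈ Metric.closedBall (0 : ℂ) 1}} :=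
    isCompact_pi_infinite fun _ => isCompact_pi_infinite fun _ => isCompact_closedBall 0 1
  refine isCompact_iff_compactSpace.mp (hK.of_isClosed_subset hclosed ?_)
  intro U hU i j
  simpa using entry_norm_bound_of_unitary hU i j

/-- The normalized Haar measure of the compact group `U(d)`. -/
noncomputable def haarUnitary (d : ℕ) : Measure (UGroup d) :=
  Measure.haarMeasure (⊤ : TopologicalSpace.PositiveCompacts (UGroup d))

/-- Operators on the `k`-copy space `(ℂ^d)^{⊗k}`, written as matrices in the computational basis
`|a⟩ = |a₁ … a_k⟩`, which is indexed by the `k`-dit strings `a : Fin k → Fin d`. -/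
abbrev CopyOp (k d : ℕ) : Type := Matrix (Fin k → Fin d) (Fin k → Fin d) ℂ

/-- The tensor power `A^{⊗k}`, with entries `⟨a| A^{⊗k} |b⟩ = ∏ᵢ ⟨aᵢ| A |bᵢ⟩`. -/
def tensorPow (k : ℕ) {d : ℕ} (A : Matrix (Fin d) (Fin d) ℂ) : CopyOp k d :=
  Matrix.of fun a b => ∏ i, A (a i) (b i)

/-- The `k`-fold twirling `X ↦ 𝔼_U U^{⊗k} X (U†)^{⊗k}` over a unitary ensemble, that is, a
probability measure `E` on `U(d)` (the expectation of a matrix is taken entrywise). -/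
noncomputable def twirl (k : ℕ) {d : ℕ} (E : Measure (UGroup d)) (X : CopyOp k d) : CopyOp k d :=
  Matrix.of fun a b =>
    ∫ U : UGroup d, (tensorPow k (U : Matrix (Fin d) (Fin d) ℂ) * X *
      tensorPow k (U : Matrix (Fin d) (Fin d) ℂ)ᴴ) a b ∂E

/-- The twirling with the unitaries on the other side, `X ↦ 𝔼_U (U†)^{⊗k} X U^{⊗k}`. -/
noncomputable def twirlDual (k : ℕ) {d : ℕ} (E : Measure (UGroup d)) (X : CopyOp k d) :
    CopyOp k d :=
  Matrix.of fun a b =>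
    ∫ U : UGroup d, (tensorPow k (U : Matrix (Fin d) (Fin d) ℂ)ᴴ * X *
      tensorPow k (U : Matrix (Fin d) (Fin d) ℂ)) a b ∂E

/-- `E` is a unitary `k`-design: a probability measure on `U(d)` (for instance the uniform one on
a finite set of unitaries) whose `k`-fold twirling agrees with that of the Haar measure. -/
structure IsUnitaryDesign (k : ℕ) {d : ℕ} (E : Measure (UGroup d)) : Prop where
  isProbabilityMeasure : IsProbabilityMeasure E
  twirl_eq : ∀ X : CopyOp k d, twirl k E X = twirl k (haarUnitary d) X

/-- A quantum state (density matrix) on `ℂ^d`: positive semidefinite with unit trace. -/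
structure IsState {d : ℕ} (ρ : Matrix (Fin d) (Fin d) ℂ) : Prop where
  posSemidef : ρ.PosSemidef
  trace_eq_one : ρ.trace = 1

/-- The weight of a dit string: the number of equal values in it, that is, the largest
multiplicity of a value. So `wt (0,2,3) = 1`, `wt (0,1,1) = 2` and `wt (1,1,1) = 3`. -/
def wt {k d : ℕ} (a : Fin k → Fin d) : ℕ :=
  Finset.univ.sup fun s : Fin d => (Finset.univ.filter fun i => a i = s).card

/-- The diagonal observable `O₊ = ∑_a [1 + (-d)^(wt(a) - 1)] |a⟩⟨a|` on three copies. The weight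
of a string of length three is at least one, so the exponent is not truncated. -/
noncomputable def Oplus (d : ℕ) : CopyOp 3 d :=
  Matrix.diagonal fun a => 1 + (-(d : ℂ)) ^ (wt a - 1)

/-! ### The Haar measure of the unitary group -/

/-! By cyclicity of the trace the twirl moves onto the state, and the design property replaces `E`
by Haar measure, so the quantity is the Haar mean of Tr[O₊² (U†ρU)^{⊗3}]. Since O₊² is diagonal and
its eigenvalues depend only on which of the three labels coincide, this trace is an affine
combination of ∑ pₛ² and ∑ pₛ³, where pₛ is the s-th diagonal entry of U†ρU (`trace_Oplus_sq_mul`).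

Left invariance absorbs the eigenbasis of ρ into U. Then pₛ = ∑ xᵢ |Uᵢₛ|² with xᵢ the eigenvalues,
and only third moments of the weights |vᵢ|² of a Haar random column v are needed. No Weingarten
calculus is used: permutation symmetry and one mixing of two coordinates (`colMean_mixed`) force the
moments with three, two and no equal indices into the ratio 6 : 2 : 1, and ∑ |vᵢ|² = 1 fixes the
scale.

For the opposite convention, trace duality turns the dual twirl of O₊² into the twirl of ρ^{⊗3}. The
design property applies there too, and Haar measure is invariant under inversion. -/

instance haarUnitary.instIsHaarMeasure (d : ℕ) : (haarUnitary d).IsHaarMeasure := by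
  unfold haarUnitary; infer_instance

instance haarUnitary.instIsProbabilityMeasure (d : ℕ) : IsProbabilityMeasure (haarUnitary d) := by
  constructor
  simpa [haarUnitary] using
    Measure.haarMeasure_self (K₀ := (⊤ : TopologicalSpace.PositiveCompacts (UGroup d)))

/-- A left invariant probability measure on `U(d)` is the Haar measure. -/
theorem eq_haarUnitary_of_isMulLeftInvariant {d : ℕ} (μ : Measure (UGroup d))
    [μ.IsMulLeftInvariant] [IsProbabilityMeasure μ] : μ = haarUnitary d := by
  -- Uniqueness holds up to a scalar; comparing total masses shows the scalar is 1.
  have h := Measure.isMulInvariant_eq_smul_of_compactSpace μ (haarUnitary d)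
  have h1 := congrArg (fun ν : Measure (UGroup d) => ν Set.univ) h
  simp only [measure_univ, Measure.smul_apply, ENNReal.smul_def, smul_eq_mul, mul_one] at h1
  ext t _
  have h2 := congrArg (fun ν : Measure (UGroup d) => ν t) h
  simpa [Measure.smul_apply, ENNReal.smul_def, ← h1] using h2

/-- Left and right translations commute, so a right translate of Haar measure is again a left
invariant probability measure. -/
instance haarUnitary.instIsMulRightInvariant (d : ℕ) : (haarUnitary d).IsMulRightInvariant := by
  constructor
  intro g
  have : IsProbabilityMeasure ((haarUnitary d).map (· * g)) :=
    Measure.isProbabilityMeasure_map (by fun_prop)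
  exact eq_haarUnitary_of_isMulLeftInvariant _

/-- Inversion turns right invariance into left invariance, so uniqueness applies once more. -/
instance haarUnitary.instIsInvInvariant (d : ℕ) : (haarUnitary d).IsInvInvariant := by
  constructor
  have : IsProbabilityMeasure (haarUnitary d).inv :=
    Measure.isProbabilityMeasure_map (by fun_prop)
  exact eq_haarUnitary_of_isMulLeftInvariant _

/-- Continuous functions on `U(d)` are integrable with respect to every finite measure. -/
theorem Continuous.integrable_unitary {d : ℕ} {f : UGroup d → ℂ} (hf : Continuous f)
    (μ : Measure (UGroup d)) [IsFiniteMeasure μ] : Integrable f μ :=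
  hf.integrable_of_hasCompactSupport (HasCompactSupport.of_compactSpace f)

/-! ### Moments of the components of a Haar random unit vector -/

/-- The component weights `|vᵢ|²` of a vector, as complex numbers. -/
def bornWeight {d : ℕ} (v : Fin d → ℂ) (i : Fin d) : ℂ := v i * star (v i)

/-- The mean of `F` over the `s`-th column of a Haar random unitary matrix. -/
noncomputable def colMean {d : ℕ} (s : Fin d) (F : (Fin d → ℂ) → ℂ) : ℂ :=
  ∫ U : UGroup d, F (fun i => (U : Matrix (Fin d) (Fin d) ℂ) i s) ∂(haarUnitary d)

/-- The s-th column of VU is V applied to the s-th column of U, so this is left invariance of Haar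
measure. -/
theorem colMean_mulVec {d : ℕ} (s : Fin d) (F : (Fin d → ℂ) → ℂ) (V : UGroup d) :
    colMean s (fun v => F ((V : Matrix (Fin d) (Fin d) ℂ) *ᵥ v)) = colMean s F := by
  unfold colMean
  rw [← integral_mul_left_eq_self
    (fun U : UGroup d => F fun i => (U : Matrix (Fin d) (Fin d) ℂ) i s) V]
  rfl

theorem continuous_unitary_entry {d : ℕ} (i j : Fin d) :
    Continuous fun U : UGroup d => (U : Matrix (Fin d) (Fin d) ℂ) i j :=
  (continuous_id.matrix_elem i j).comp continuous_subtype_val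

theorem continuous_bornWeight {d : ℕ} (i : Fin d) :
    Continuous fun v : Fin d → ℂ => bornWeight v i := by
  unfold bornWeight; fun_prop

theorem integrable_col {d : ℕ} (s : Fin d) {F : (Fin d → ℂ) → ℂ} (hF : Continuous F) :
    Integrable (fun U : UGroup d => F fun i => (U : Matrix (Fin d) (Fin d) ℂ) i s)
      (haarUnitary d) :=
  Continuous.integrable_unitary
    (hF.comp (continuous_pi fun i => continuous_unitary_entry i s)) _

theorem colMean_add {d : ℕ} (s : Fin d) {F G : (Fin d → ℂ) → ℂ} (hF : Continuous F)
    (hG : Continuous G) : colMean s (fun v => F v + G v) = colMean s F + colMean s G :=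
  integral_add (integrable_col s hF) (integrable_col s hG)

theorem colMean_const_mul {d : ℕ} (s : Fin d) (c : ℂ) (F : (Fin d → ℂ) → ℂ) :
    colMean s (fun v => c * F v) = c * colMean s F :=
  integral_const_mul c _

theorem colMean_sum {d : ℕ} {ι : Type*} (t : Finset ι) (s : Fin d) {F : ι → (Fin d → ℂ) → ℂ}
    (hF : ∀ i, Continuous (F i)) :
    colMean s (fun v => ∑ i ∈ t, F i v) = ∑ i ∈ t, colMean s (F i) :=
  integral_finsetSum t fun i _ => integrable_col s (hF i)

theorem sum_bornWeight_col {d : ℕ} (U : UGroup d) (s : Fin d) :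
    ∑ i, bornWeight (fun i => (U : Matrix (Fin d) (Fin d) ℂ) i s) i = 1 := by
  have h := congrFun (congrFun (Matrix.mem_unitaryGroup_iff'.mp U.2) s) s
  rw [Matrix.mul_apply] at h
  simpa [bornWeight, Matrix.star_apply, mul_comm] using h

/-- The unitary matrix permuting the coordinates by `σ`. -/
def permUnitary {d : ℕ} (σ : Equiv.Perm (Fin d)) : UGroup d :=
  ⟨σ.permMatrix ℂ, by
    rw [Matrix.mem_unitaryGroup_iff, Matrix.star_eq_conjTranspose, Matrix.conjTranspose_permMatrix,
      ← Matrix.permMatrix_mul]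
    simp⟩

/-- The square root `(1 + i)/2 + (1 - i)/2 P` of the matrix `P` swapping two coordinates. -/
noncomputable def sqrtSwap {d : ℕ} (i j : Fin d) : UGroup d :=
  ⟨((1 + Complex.I) / 2) • (1 : Matrix (Fin d) (Fin d) ℂ) +
      ((1 - Complex.I) / 2) • (Equiv.swap i j).permMatrix ℂ, by
    have hP : (Equiv.swap i j).permMatrix ℂ * (Equiv.swap i j).permMatrix ℂ = 1 := by
      rw [← Matrix.permMatrix_mul]; simp
    rw [Matrix.mem_unitaryGroup_iff, Matrix.star_eq_conjTranspose]
    simp only [Matrix.conjTranspose_add, Matrix.conjTranspose_smul, Matrix.conjTranspose_one,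
      Matrix.conjTranspose_permMatrix, Equiv.swap_inv, mul_add, add_mul, smul_mul_smul_comm, hP,
      mul_one, one_mul]
    -- For a self-adjoint involution P, α + βP is unitary when |α|² + |β|² = 1 and the cross terms
    -- cancel.
    have h1 : (1 + Complex.I) / 2 * star ((1 + Complex.I) / 2) +
        (1 - Complex.I) / 2 * star ((1 - Complex.I) / 2) = 1 := by
      simp [Complex.ext_iff]; norm_num
    have h2 : (1 - Complex.I) / 2 * star ((1 + Complex.I) / 2) +
        (1 + Complex.I) / 2 * star ((1 - Complex.I) / 2) = 0 := by
      simp [Complex.ext_iff]; norm_num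
    calc _ = ((1 + Complex.I) / 2 * star ((1 + Complex.I) / 2) +
          (1 - Complex.I) / 2 * star ((1 - Complex.I) / 2)) • (1 : Matrix (Fin d) (Fin d) ℂ) +
          ((1 - Complex.I) / 2 * star ((1 + Complex.I) / 2) +
          (1 + Complex.I) / 2 * star ((1 - Complex.I) / 2)) • (Equiv.swap i j).permMatrix ℂ := by
            rw [add_smul, add_smul]; abel
      _ = 1 := by rw [h1, h2, one_smul, zero_smul, add_zero]⟩

/-- The diagonal unitary matrix with entry `i` at position `j` and `1` elsewhere. -/
noncomputable def quarterPhase {d : ℕ} (j : Fin d) : UGroup d :=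
  ⟨Matrix.diagonal fun a => if a = j then Complex.I else 1, by
    rw [Matrix.mem_unitaryGroup_iff, Matrix.star_eq_conjTranspose, Matrix.diagonal_conjTranspose,
      Matrix.diagonal_mul_diagonal, ← Matrix.diagonal_one]
    congr 1
    ext a
    by_cases h : a = j <;> simp [h]⟩

theorem permUnitary_mulVec {d : ℕ} (σ : Equiv.Perm (Fin d)) (v : Fin d → ℂ) (a : Fin d) :
    ((permUnitary σ : Matrix (Fin d) (Fin d) ℂ) *ᵥ v) a = v (σ a) := by
  simp [permUnitary, Matrix.permMatrix_mulVec]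

theorem sqrtSwap_mulVec {d : ℕ} (i j : Fin d) (v : Fin d → ℂ) (a : Fin d) :
    ((sqrtSwap i j : Matrix (Fin d) (Fin d) ℂ) *ᵥ v) a =
      (1 + Complex.I) / 2 * v a + (1 - Complex.I) / 2 * v (Equiv.swap i j a) := by
  simp [sqrtSwap, Matrix.add_mulVec, Matrix.smul_mulVec, Matrix.permMatrix_mulVec]

theorem quarterPhase_mulVec {d : ℕ} (j : Fin d) (v : Fin d → ℂ) (a : Fin d) :
    ((quarterPhase j : Matrix (Fin d) (Fin d) ℂ) *ᵥ v) a = (if a = j then Complex.I else 1) * v a := by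
  simp [quarterPhase, Matrix.mulVec_diagonal]

/-- The third moments of the component weights of a Haar random unit vector. -/
noncomputable def weightMoment {d : ℕ} (s i j k : Fin d) : ℂ :=
  colMean s fun v => bornWeight v i * bornWeight v j * bornWeight v k

theorem weightMoment_perm {d : ℕ} (s i j k : Fin d) (σ : Equiv.Perm (Fin d)) :
    weightMoment s (σ i) (σ j) (σ k) = weightMoment s i j k := by
  unfold weightMoment
  rw [← colMean_mulVec s (fun v => bornWeight v i * bornWeight v j * bornWeight v k)
    (permUnitary σ)]
  simp only [bornWeight, permUnitary_mulVec]

theorem weightMoment_swap_left {d : ℕ} (s i j k : Fin d) :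
    weightMoment s j i k = weightMoment s i j k := by
  unfold weightMoment; congr 1; ext v; ring

theorem weightMoment_swap_right {d : ℕ} (s i j k : Fin d) :
    weightMoment s i k j = weightMoment s i j k := by
  unfold weightMoment; congr 1; ext v; ring

/-- Mixing the coordinates `i` and `j` turns a mixed moment into pure ones. -/
theorem colMean_mixed {d : ℕ} (s : Fin d) {i j : Fin d} (hij : i ≠ j) {w : (Fin d → ℂ) → ℂ}
    (hw : Continuous w)
    (h1 : ∀ v, w ((sqrtSwap i j : Matrix (Fin d) (Fin d) ℂ) *ᵥ v) = w v)
    (h2 : ∀ v, w ((quarterPhase j : Matrix (Fin d) (Fin d) ℂ) *ᵥ v) = w v) :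
    colMean s (fun v => bornWeight v i * bornWeight v j * w v) =
      1 / 4 * colMean s (fun v => (bornWeight v i ^ 2 + bornWeight v j ^ 2) * w v) := by
  set F : (Fin d → ℂ) → ℂ := fun v => bornWeight v i * bornWeight v j * w v with hF
  have hFc : Continuous F :=
    ((continuous_bornWeight i).mul (continuous_bornWeight j)).mul hw
  have e1 := colMean_mulVec s F (sqrtSwap i j)
  have e2 := colMean_mulVec s (fun v => F ((sqrtSwap i j : Matrix (Fin d) (Fin d) ℂ) *ᵥ v))
    (quarterPhase j)
  have c1 : Continuous fun v : Fin d → ℂ => F ((sqrtSwap i j : Matrix (Fin d) (Fin d) ℂ) *ᵥ v) :=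
    hFc.comp (by fun_prop)
  have c2 : Continuous fun v : Fin d → ℂ => F ((sqrtSwap i j : Matrix (Fin d) (Fin d) ℂ) *ᵥ
      ((quarterPhase j : Matrix (Fin d) (Fin d) ℂ) *ᵥ v)) := c1.comp (by fun_prop)
  -- With m the average of the two weights, `sqrtSwap` sends them to m ± Im(vᵢ v̄ⱼ) up to order;
  -- inserting the quarter phase first gives m ± Re(vᵢ v̄ⱼ). The two products sum to 2m² -
  -- |vᵢ|²|vⱼ|² = (|vᵢ|⁴ + |vⱼ|⁴)/2.
  have e3 : colMean s (fun v => (bornWeight v i ^ 2 + bornWeight v j ^ 2) * w v) =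
      2 * (colMean s (fun v => F ((sqrtSwap i j : Matrix (Fin d) (Fin d) ℂ) *ᵥ v)) +
        colMean s (fun v => F ((sqrtSwap i j : Matrix (Fin d) (Fin d) ℂ) *ᵥ
          ((quarterPhase j : Matrix (Fin d) (Fin d) ℂ) *ᵥ v)))) := by
    rw [← colMean_add s c1 c2, ← colMean_const_mul]
    congr 1
    ext v
    simp only [hF, h1, h2]
    simp only [bornWeight, sqrtSwap_mulVec, quarterPhase_mulVec, Equiv.swap_apply_left,
      Equiv.swap_apply_right, hij, if_true, if_false]
    simp only [star_add, star_mul', star_div₀, star_sub, star_one, star_ofNat, Complex.star_def,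
      Complex.conj_I]
    generalize (starRingEnd ℂ) (v i) = x
    generalize (starRingEnd ℂ) (v j) = y
    generalize w v = z
    have hI : Complex.I ^ 2 = -1 := Complex.I_sq
    have hI3 : Complex.I ^ 3 = -Complex.I := by rw [pow_succ, hI]; ring
    have hI4 : Complex.I ^ 4 = 1 := Complex.I_pow_four
    have hI5 : Complex.I ^ 5 = Complex.I := by rw [pow_succ, hI4]; ring
    have hI6 : Complex.I ^ 6 = -1 := by rw [pow_succ, hI5, ← sq, hI]
    have hI7 : Complex.I ^ 7 = -Complex.I := by rw [pow_succ, hI6]; ring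
    have hI8 : Complex.I ^ 8 = 1 := by rw [pow_succ, hI7]; linear_combination -hI
    ring_nf
    simp only [hI, hI3, hI4, hI5, hI6, hI7, hI8]
    ring
  rw [e3, e2, e1]
  ring

theorem weightMoment_self {d : ℕ} (s i j : Fin d) :
    weightMoment s i i i = weightMoment s j j j := by
  simpa using weightMoment_perm s j j j (Equiv.swap i j)

theorem weightMoment_pair_swap {d : ℕ} (s i j : Fin d) :
    weightMoment s j j i = weightMoment s i i j := by
  simpa using weightMoment_perm s i i j (Equiv.swap i j)

theorem continuous_weightMonomial {d : ℕ} (i j k : Fin d) :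
    Continuous fun v : Fin d → ℂ => bornWeight v i * bornWeight v j * bornWeight v k :=
  ((continuous_bornWeight i).mul (continuous_bornWeight j)).mul (continuous_bornWeight k)

/-- Taking w = |vᵢ|² + |vⱼ|², which both unitaries preserve, the mixing identity reads 2a = (2b +
2a)/4, with a the pair moment and b the pure one. -/
theorem weightMoment_pair {d : ℕ} (s : Fin d) {i j : Fin d} (hij : i ≠ j) :
    weightMoment s i i j = 1 / 3 * weightMoment s i i i := by
  have h := colMean_mixed s hij (w := fun v => bornWeight v i + bornWeight v j)
    ((continuous_bornWeight i).add (continuous_bornWeight j)) ?_ ?_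
  · have l : colMean s (fun v => bornWeight v i * bornWeight v j *
        (bornWeight v i + bornWeight v j)) = weightMoment s i j i + weightMoment s i j j := by
      rw [weightMoment, weightMoment, ← colMean_add s (continuous_weightMonomial i j i)
        (continuous_weightMonomial i j j)]
      congr 1; ext v; ring
    have r : colMean s (fun v => (bornWeight v i ^ 2 + bornWeight v j ^ 2) *
        (bornWeight v i + bornWeight v j)) =
        (weightMoment s i i i + weightMoment s i i j) +
          (weightMoment s j j i + weightMoment s j j j) := by
      simp only [weightMoment]
      rw [← colMean_add s (continuous_weightMonomial i i i) (continuous_weightMonomial i i j),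
        ← colMean_add s (continuous_weightMonomial j j i) (continuous_weightMonomial j j j),
        ← colMean_add s
          (F := fun v => bornWeight v i * bornWeight v i * bornWeight v i +
            bornWeight v i * bornWeight v i * bornWeight v j)
          (G := fun v => bornWeight v j * bornWeight v j * bornWeight v i +
            bornWeight v j * bornWeight v j * bornWeight v j)
          ((continuous_weightMonomial i i i).add (continuous_weightMonomial i i j))
          ((continuous_weightMonomial j j i).add (continuous_weightMonomial j j j))]
      congr 1; ext v; ring
    rw [l, r, weightMoment_swap_right s i i j, weightMoment_self s j i,
      ← weightMoment_swap_left s i j j, weightMoment_swap_right s j j i,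
      weightMoment_pair_swap s i j] at h
    linear_combination 2 / 3 * h
  · intro v
    simp only [bornWeight, sqrtSwap_mulVec, Equiv.swap_apply_left, Equiv.swap_apply_right]
    simp only [star_add, star_mul', star_div₀, star_sub, star_one, star_ofNat, Complex.star_def,
      Complex.conj_I]
    linear_combination (-1 / 2 : ℂ) * (v i - v j) *
      ((starRingEnd ℂ) (v i) - (starRingEnd ℂ) (v j)) * Complex.I_sq
  · intro v
    simp only [bornWeight, quarterPhase_mulVec, hij, if_true, if_false, star_mul', star_one,
      Complex.star_def, Complex.conj_I]
    linear_combination -(v j) * (starRingEnd ℂ) (v j) * Complex.I_sq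

/-- Taking w = |vₖ|², untouched by the mixing, gives (1/4)(1/3 + 1/3) = 1/6 of the pure moment. -/
theorem weightMoment_distinct {d : ℕ} (s : Fin d) {i j k : Fin d} (hij : i ≠ j) (hik : i ≠ k)
    (hjk : j ≠ k) : weightMoment s i j k = 1 / 6 * weightMoment s i i i := by
  have h := colMean_mixed s hij (w := fun v => bornWeight v k) (continuous_bornWeight k) ?_ ?_
  · have r : colMean s (fun v => (bornWeight v i ^ 2 + bornWeight v j ^ 2) * bornWeight v k) =
        weightMoment s i i k + weightMoment s j j k := by
      rw [weightMoment, weightMoment, ← colMean_add s (continuous_weightMonomial i i k)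
        (continuous_weightMonomial j j k)]
      congr 1; ext v; ring
    rw [r, weightMoment_pair s hik, weightMoment_pair s hjk, weightMoment_self s j i] at h
    rw [weightMoment, h]
    ring
  · intro v
    simp only [bornWeight, sqrtSwap_mulVec, Equiv.swap_apply_of_ne_of_ne hik.symm hjk.symm]
    congr 1 <;> ring_nf
  · intro v
    simp [bornWeight, quarterPhase_mulVec, hjk.symm]

/-- The bracket counts the permutations of three positions that fix (i, j, k): the identity, three
transpositions and two 3-cycles. Its values are 6, 2 and 1. -/
theorem weightMoment_eq_mul {d : ℕ} (s i j k : Fin d) :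
    weightMoment s i j k = 1 / 6 * weightMoment s s s s *
      (1 + (if i = j then 1 else 0) + (if i = k then 1 else 0) + (if j = k then 1 else 0) +
        2 * (if i = j then if j = k then 1 else 0 else 0)) := by
  rw [weightMoment_self s s i]
  by_cases hij : i = j
  · subst hij
    by_cases hik : i = k
    · subst hik
      simp only [if_true]; ring
    · rw [weightMoment_pair s hik]
      simp only [hik, if_true, if_false]; ring
  · by_cases hik : i = k
    · subst hik
      rw [weightMoment_swap_right, weightMoment_pair s hij]
      simp only [hij, Ne.symm hij, if_true, if_false]; ring
    · by_cases hjk : j = k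
      · subst hjk
        rw [← weightMoment_swap_left, weightMoment_swap_right, weightMoment_pair s (Ne.symm hij),
          weightMoment_self s j i]
        simp only [hij, if_true, if_false]; ring
      · rw [weightMoment_distinct s hij hik hjk]
        simp only [hij, hik, hjk, if_false]; ring

/-- The mean of a product of three diagonal observables over a Haar random unit vector. -/
theorem colMean_mul_mul {d : ℕ} (s : Fin d) (x y z : Fin d → ℂ) :
    colMean s (fun v => (∑ i, x i * bornWeight v i) * (∑ j, y j * bornWeight v j) *
      (∑ k, z k * bornWeight v k)) = 1 / 6 * weightMoment s s s s *
      ((∑ i, x i) * (∑ i, y i) * (∑ i, z i) + (∑ i, x i * y i) * (∑ i, z i) +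
        (∑ i, x i * z i) * (∑ i, y i) + (∑ i, y i * z i) * (∑ i, x i) +
        2 * ∑ i, x i * y i * z i) := by
  have h1 : (fun v : Fin d → ℂ => (∑ i, x i * bornWeight v i) * (∑ j, y j * bornWeight v j) *
      (∑ k, z k * bornWeight v k)) = fun v => ∑ i, ∑ j, ∑ k, x i * y j * z k *
        (bornWeight v i * bornWeight v j * bornWeight v k) := by
    ext v
    rw [Finset.sum_mul_sum, Finset.sum_mul]
    refine Finset.sum_congr rfl fun i _ => ?_
    rw [Finset.sum_mul_sum]
    refine Finset.sum_congr rfl fun j _ => Finset.sum_congr rfl fun k _ => ?_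
    ring
  have c : ∀ i j k, Continuous fun v : Fin d → ℂ => x i * y j * z k *
      (bornWeight v i * bornWeight v j * bornWeight v k) :=
    fun i j k => continuous_const.mul (continuous_weightMonomial i j k)
  rw [h1, colMean_sum _ _ fun i => continuous_finsetSum _ fun j _ =>
    continuous_finsetSum _ fun k _ => c i j k]
  have h2 : ∀ i j k, colMean s (fun v : Fin d → ℂ => x i * y j * z k *
      (bornWeight v i * bornWeight v j * bornWeight v k)) = 1 / 6 * weightMoment s s s s *
      (x i * y j * z k + (if i = j then x i * y j * z k else 0) +
        (if i = k then x i * y j * z k else 0) + (if j = k then x i * y j * z k else 0) +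
        2 * (if i = j then if j = k then x i * y j * z k else 0 else 0)) := by
    intro i j k
    rw [colMean_const_mul, ← weightMoment, weightMoment_eq_mul s i j k]
    split_ifs <;> ring
  have h3 : ∀ i, colMean s (fun v => ∑ j, ∑ k, x i * y j * z k *
      (bornWeight v i * bornWeight v j * bornWeight v k)) =
      ∑ j, ∑ k, colMean s (fun v => x i * y j * z k *
      (bornWeight v i * bornWeight v j * bornWeight v k)) := by
    intro i
    rw [colMean_sum _ _ fun j => continuous_finsetSum _ fun k _ => c i j k]
    exact Finset.sum_congr rfl fun j _ => colMean_sum _ _ fun k => c i j k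
  simp only [h3]
  simp only [h2, ← Finset.mul_sum]
  congr 1
  have e1 : ∑ i, ∑ j, ∑ k, x i * y j * z k = (∑ i, x i) * (∑ i, y i) * (∑ i, z i) := by
    simp only [← Finset.mul_sum, ← Finset.sum_mul]
  have e2 : ∑ i, ∑ j, ∑ k, (if i = j then x i * y j * z k else 0) =
      (∑ i, x i * y i) * (∑ i, z i) := by
    simp [Finset.sum_ite_irrel, Finset.sum_mul_sum]
  have e3 : ∑ i, ∑ j, ∑ k, (if i = k then x i * y j * z k else 0) =
      (∑ i, x i * z i) * (∑ i, y i) := by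
    simp [Finset.sum_mul_sum, mul_right_comm]
  have e4 : ∑ i, ∑ j, ∑ k, (if j = k then x i * y j * z k else 0) =
      (∑ i, y i * z i) * (∑ i, x i) := by
    simp only [Finset.sum_ite_eq, Finset.mem_univ, if_true, mul_assoc, ← Finset.mul_sum,
      ← Finset.sum_mul]
    rw [mul_comm]
  have e5 : ∑ i, ∑ j, ∑ k, (if i = j then if j = k then x i * y j * z k else 0 else 0) =
      ∑ i, x i * y i * z i := by
    simp [Finset.sum_ite_irrel]
  simp only [Finset.sum_add_distrib, ← Finset.mul_sum] at e1 e2 e3 e4 e5 ⊢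
  simp only [e1, e2, e3, e4, e5]

/-- The normalization of the third moments. -/
theorem weightMoment_self_mul {d : ℕ} (s : Fin d) :
    1 / 6 * weightMoment s s s s * ((d : ℂ) * (d + 1) * (d + 2)) = 1 := by
  -- For x = y = z = 1 the integrand is 1 on unit columns, and the bracket is d³ + 3d² + 2d.
  have h := colMean_mul_mul s (fun _ => 1) (fun _ => 1) (fun _ => 1)
  simp only [one_mul, Finset.sum_const, Finset.card_univ, Fintype.card_fin, nsmul_eq_mul,
    mul_one] at h
  rw [colMean] at h
  simp only [sum_bornWeight_col, mul_one, integral_const, probReal_univ, one_smul] at h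
  linear_combination -h

/-- The third moment of the mean of a diagonal observable with trace one. -/
theorem colMean_cube {d : ℕ} (s : Fin d) (x : Fin d → ℂ) (hx : ∑ i, x i = 1) :
    colMean s (fun v => (∑ i, x i * bornWeight v i) ^ 3) * ((d : ℂ) * (d + 1) * (d + 2)) =
      1 + 3 * (∑ i, x i ^ 2) + 2 * ∑ i, x i ^ 3 := by
  have h := colMean_mul_mul s x x x
  simp only [hx, ← pow_two, ← pow_succ] at h
  rw [h]
  linear_combination (1 + 3 * (∑ i, x i ^ 2) + 2 * ∑ i, x i ^ 3) * weightMoment_self_mul s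

/-- The second moment of the mean of a diagonal observable with trace one. -/
theorem colMean_sq {d : ℕ} (s : Fin d) (x : Fin d → ℂ) (hx : ∑ i, x i = 1) :
    colMean s (fun v => (∑ i, x i * bornWeight v i) ^ 2) * ((d : ℂ) * (d + 1)) =
      1 + ∑ i, x i ^ 2 := by
  -- A third factor equal to 1 on unit columns reduces the second moment to the third; the bracket
  -- becomes (d + 2)(1 + ∑ xᵢ²).
  have h := colMean_mul_mul s x x (fun _ => 1)
  have h' : colMean s (fun v => (∑ i, x i * bornWeight v i) * (∑ i, x i * bornWeight v i) *
      (∑ i, 1 * bornWeight v i)) = colMean s (fun v => (∑ i, x i * bornWeight v i) ^ 2) := by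
    simp only [colMean, one_mul, sum_bornWeight_col, mul_one, pow_two]
  rw [h'] at h
  simp only [hx, mul_one, ← pow_two, Finset.sum_const, Finset.card_univ, Fintype.card_fin,
    nsmul_eq_mul] at h
  rw [h]
  linear_combination (1 + ∑ i, x i ^ 2) * weightMoment_self_mul s

/-! ### The observable `O₊²` -/

theorem sum_fin_three {d : ℕ} (g : Fin d → Fin d → Fin d → ℂ) :
    ∑ a : Fin 3 → Fin d, g (a 0) (a 1) (a 2) = ∑ i, ∑ j, ∑ k, g i j k := by
  have e : ∑ a : Fin 3 → Fin d, g (a 0) (a 1) (a 2) =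
      ∑ p : Fin d × Fin d × Fin d, g p.1 p.2.1 p.2.2 :=
    Fintype.sum_equiv
      { toFun := fun a => (a 0, a 1, a 2)
        invFun := fun p => ![p.1, p.2.1, p.2.2]
        left_inv := fun a => by ext i; fin_cases i <;> rfl
        right_inv := fun p => rfl } _ _ fun a => rfl
  rw [e, Fintype.sum_prod_type]
  simp only [Fintype.sum_prod_type]

theorem wt_three {d : ℕ} (a : Fin 3 → Fin d) :
    wt a = if a 0 = a 1 then if a 1 = a 2 then 3 else 2
      else if a 0 = a 2 then 2 else if a 1 = a 2 then 2 else 1 := by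
  have hc : ∀ s : Fin d, (Finset.univ.filter fun i => a i = s).card =
      (if a 0 = s then 1 else 0) + (if a 1 = s then 1 else 0) + (if a 2 = s then 1 else 0) := by
    intro s
    rw [Finset.card_filter, Fin.sum_univ_three]
  unfold wt
  simp only [hc]
  apply le_antisymm
  · refine Finset.sup_le fun s _ => ?_
    split_ifs <;> omega
  -- The largest multiplicity is attained at `a 0` or at `a 1`; the latter is needed only when `a 1
  -- = a 2` differs from `a 0`.
  · have h0 := Finset.le_sup (s := Finset.univ) (f := fun s : Fin d => (if a 0 = s then 1 else 0) +
      (if a 1 = s then 1 else 0) + (if a 2 = s then 1 else 0)) (Finset.mem_univ (a 0))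
    have h1 := Finset.le_sup (s := Finset.univ) (f := fun s : Fin d => (if a 0 = s then 1 else 0) +
      (if a 1 = s then 1 else 0) + (if a 2 = s then 1 else 0)) (Finset.mem_univ (a 1))
    refine le_trans ?_ (max_le h0 h1)
    by_cases h01 : a 0 = a 1 <;> by_cases h12 : a 1 = a 2 <;> by_cases h02 : a 0 = a 2 <;>
      simp_all [eq_comm]

/-- `O₊²` expanded in indicators of coinciding values. -/
theorem Oplus_sq {d : ℕ} : Oplus d ^ 2 = Matrix.diagonal fun a => 4 +
    ((d : ℂ) - 3) * (d + 1) * ((if a 0 = a 1 then 1 else 0) + (if a 0 = a 2 then 1 else 0) +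
      (if a 1 = a 2 then 1 else 0)) +
    ((d : ℂ) + 1) * ((d : ℂ) ^ 3 - (d : ℂ) ^ 2 + 6) *
      (if a 0 = a 1 then if a 1 = a 2 then 1 else 0 else 0) := by
  rw [Oplus, Matrix.diagonal_pow]
  congr 1
  ext a
  -- The squared eigenvalues are 4, (1 - d)² and (1 + d²)². The pair coefficient is (1 - d)² - 4,
  -- and the triple one is (1 + d²)² - 4 minus three pair coefficients.
  rw [Pi.pow_apply, wt_three]
  by_cases h01 : a 0 = a 1 <;> by_cases h12 : a 1 = a 2 <;> by_cases h02 : a 0 = a 2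
  -- Patterns with exactly two of the three equalities contradict transitivity.
  all_goals first | (exfalso; simp_all; done) | skip
  all_goals
    simp only [h01, h12, h02, if_true, if_false]
    try simp only [← h02, h01, if_false]
    norm_num
    try ring

/-- A diagonal operator sees only the diagonal of B^{⊗3}; every label left free by the indicators
sums to Tr B = 1. -/
theorem trace_Oplus_sq_mul {d : ℕ} (B : Matrix (Fin d) (Fin d) ℂ) (hB : B.trace = 1) :
    (Oplus d ^ 2 * tensorPow 3 B).trace =
      4 + 3 * (((d : ℂ) - 3) * (d + 1)) * ∑ s, B s s ^ 2 +
        ((d : ℂ) + 1) * ((d : ℂ) ^ 3 - (d : ℂ) ^ 2 + 6) * ∑ s, B s s ^ 3 := by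
  have hB' : ∑ s, B s s = 1 := hB
  rw [Oplus_sq, Matrix.trace]
  simp only [Matrix.diag_apply, Matrix.diagonal_mul, tensorPow, Matrix.of_apply,
    Fin.prod_univ_three]
  rw [sum_fin_three (fun i j k => (4 +
    ((d : ℂ) - 3) * (d + 1) * ((if i = j then 1 else 0) + (if i = k then 1 else 0) +
      (if j = k then 1 else 0)) +
    ((d : ℂ) + 1) * ((d : ℂ) ^ 3 - (d : ℂ) ^ 2 + 6) *
      (if i = j then if j = k then 1 else 0 else 0)) * (B i i * B j j * B k k))]
  have e1 : ∑ i, ∑ j, ∑ k, B i i * B j j * B k k = 1 := by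
    simp [← Finset.mul_sum, hB']
  have e2 : ∑ i, ∑ j, ∑ k, (if i = j then B i i * B j j * B k k else 0) = ∑ s, B s s ^ 2 := by
    simp [Finset.sum_ite_irrel, ← Finset.mul_sum, hB', pow_two]
  have e3 : ∑ i, ∑ j, ∑ k, (if i = k then B i i * B j j * B k k else 0) = ∑ s, B s s ^ 2 := by
    simp [← Finset.mul_sum, ← Finset.sum_mul, hB', pow_two]
  have e4 : ∑ i, ∑ j, ∑ k, (if j = k then B i i * B j j * B k k else 0) = ∑ s, B s s ^ 2 := by
    simp [mul_assoc, ← Finset.mul_sum, ← Finset.sum_mul, hB', pow_two]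
  have e5 : ∑ i, ∑ j, ∑ k, (if i = j then if j = k then B i i * B j j * B k k else 0 else 0) =
      ∑ s, B s s ^ 3 := by
    simp [Finset.sum_ite_irrel, pow_succ]
  calc _ = ∑ i, ∑ j, ∑ k, (4 * (B i i * B j j * B k k) +
        ((d : ℂ) - 3) * (d + 1) * ((if i = j then B i i * B j j * B k k else 0) +
          (if i = k then B i i * B j j * B k k else 0) +
          (if j = k then B i i * B j j * B k k else 0)) +
        ((d : ℂ) + 1) * ((d : ℂ) ^ 3 - (d : ℂ) ^ 2 + 6) *
          (if i = j then if j = k then B i i * B j j * B k k else 0 else 0)) := by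
        refine Finset.sum_congr rfl fun i _ => Finset.sum_congr rfl fun j _ =>
          Finset.sum_congr rfl fun k _ => ?_
        split_ifs <;> ring
    _ = _ := by
      simp only [Finset.sum_add_distrib, ← Finset.mul_sum] at e1 ⊢
      rw [e1, e2, e3, e4, e5]
      ring

/-! ### Twirling as an expectation of traces -/

theorem tensorPow_mul (k : ℕ) {d : ℕ} (A B : Matrix (Fin d) (Fin d) ℂ) :
    tensorPow k (A * B) = tensorPow k A * tensorPow k B := by
  ext a b
  simp only [tensorPow, Matrix.of_apply, Matrix.mul_apply, Finset.prod_univ_sum,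
    Fintype.piFinset_univ, Finset.prod_mul_distrib]

theorem continuous_tensorPow (k d : ℕ) :
    Continuous fun A : Matrix (Fin d) (Fin d) ℂ => tensorPow k A := by
  refine continuous_matrix fun a b => ?_
  simp only [tensorPow, Matrix.of_apply]
  exact continuous_finsetProd _ fun i _ => continuous_id.matrix_elem _ _

theorem trace_integral_mul {k d : ℕ} (E : Measure (UGroup d)) [IsFiniteMeasure E]
    {G : UGroup d → CopyOp k d} (hG : Continuous G) (Y : CopyOp k d) :
    (Matrix.of (fun a b => ∫ U, G U a b ∂E) * Y).trace = ∫ U, (G U * Y).trace ∂E := by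
  simp only [Matrix.trace, Matrix.diag_apply, Matrix.mul_apply, Matrix.of_apply]
  have hi : ∀ a b, Integrable (fun U => G U a b * Y b a) E := fun a b =>
    Continuous.integrable_unitary ((hG.matrix_elem a b).mul continuous_const) E
  rw [integral_finsetSum _ fun a _ => integrable_finsetSum _ fun b _ => hi a b]
  refine Finset.sum_congr rfl fun a _ => ?_
  rw [integral_finsetSum _ fun b _ => hi a b]
  exact Finset.sum_congr rfl fun b _ => (integral_mul_const _ _).symm

/-- Cyclicity passes the random unitaries from the observable to the tensor factors. -/
theorem trace_twirl_mul_tensorPow {k d : ℕ} (E : Measure (UGroup d)) [IsFiniteMeasure E]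
    (X : CopyOp k d) (A : Matrix (Fin d) (Fin d) ℂ) :
    (twirl k E X * tensorPow k A).trace =
      ∫ U : UGroup d, (X * tensorPow k ((U : Matrix (Fin d) (Fin d) ℂ)ᴴ * A * (U : Matrix (Fin d) (Fin d) ℂ))).trace ∂E := by
  have hc : Continuous fun U : UGroup d => tensorPow k (U : Matrix (Fin d) (Fin d) ℂ) * X *
      tensorPow k (U : Matrix (Fin d) (Fin d) ℂ)ᴴ :=
    (((continuous_tensorPow k d).comp continuous_subtype_val).mul continuous_const).mul
      ((continuous_tensorPow k d).comp continuous_subtype_val.matrix_conjTranspose)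
  rw [twirl, trace_integral_mul E hc]
  congr 1
  ext U
  rw [tensorPow_mul, tensorPow_mul, Matrix.mul_assoc, Matrix.mul_assoc, Matrix.trace_mul_comm]
  simp only [Matrix.mul_assoc]

/-- The two twirlings are adjoint for the trace pairing. This matters because the design hypothesis
speaks only of `twirl`, and `E` need not be invariant under inversion. -/
theorem trace_twirlDual_mul_tensorPow {k d : ℕ} (E : Measure (UGroup d)) [IsFiniteMeasure E]
    (X : CopyOp k d) (A : Matrix (Fin d) (Fin d) ℂ) :
    (twirlDual k E X * tensorPow k A).trace = (twirl k E (tensorPow k A) * X).trace := by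
  have hc1 : Continuous fun U : UGroup d => tensorPow k (U : Matrix (Fin d) (Fin d) ℂ)ᴴ * X *
      tensorPow k (U : Matrix (Fin d) (Fin d) ℂ) :=
    (((continuous_tensorPow k d).comp continuous_subtype_val.matrix_conjTranspose).mul
      continuous_const).mul ((continuous_tensorPow k d).comp continuous_subtype_val)
  have hc2 : Continuous fun U : UGroup d => tensorPow k (U : Matrix (Fin d) (Fin d) ℂ) *
      tensorPow k A * tensorPow k (U : Matrix (Fin d) (Fin d) ℂ)ᴴ :=
    (((continuous_tensorPow k d).comp continuous_subtype_val).mul continuous_const).mul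
      ((continuous_tensorPow k d).comp continuous_subtype_val.matrix_conjTranspose)
  rw [twirlDual, twirl]
  refine (trace_integral_mul E hc1 _).trans (Eq.trans ?_ (trace_integral_mul E hc2 _).symm)
  refine integral_congr_ae (.of_forall fun U => ?_)
  simp only
  rw [Matrix.mul_assoc, Matrix.mul_assoc, Matrix.trace_mul_comm]
  simp only [Matrix.mul_assoc]
  rw [Matrix.trace_mul_comm]
  simp only [Matrix.mul_assoc]

/-- Inverting the unitaries does not change the Haar twirling. -/
theorem twirlDual_haarUnitary (k : ℕ) {d : ℕ} (X : CopyOp k d) :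
    twirlDual k (haarUnitary d) X = twirl k (haarUnitary d) X := by
  ext a b
  simp only [twirl, twirlDual, Matrix.of_apply]
  rw [← integral_inv_eq_self _ (haarUnitary d)]
  simp [Matrix.star_eq_conjTranspose]

/-- The twirlings over a design agree with the Haar twirling in both conventions. -/
theorem IsUnitaryDesign.trace_twirlDual_mul_tensorPow {k d : ℕ} {E : Measure (UGroup d)}
    (hE : IsUnitaryDesign k E) (X : CopyOp k d) (A : Matrix (Fin d) (Fin d) ℂ) :
    (twirlDual k E X * tensorPow k A).trace = (twirl k E X * tensorPow k A).trace := by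
  have := hE.isProbabilityMeasure
  rw [_root_.trace_twirlDual_mul_tensorPow, hE.twirl_eq, hE.twirl_eq,
    ← _root_.trace_twirlDual_mul_tensorPow, twirlDual_haarUnitary]

/-! ### The expectation value in a state -/

theorem conj_diagonal_apply {d : ℕ} (U : UGroup d) (x : Fin d → ℂ) (s : Fin d) :
    ((U : Matrix (Fin d) (Fin d) ℂ)ᴴ * Matrix.diagonal x * (U : Matrix (Fin d) (Fin d) ℂ)) s s =
      ∑ i, x i * bornWeight (fun i => (U : Matrix (Fin d) (Fin d) ℂ) i s) i := by
  rw [Matrix.mul_apply]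
  refine Finset.sum_congr rfl fun i _ => ?_
  rw [Matrix.mul_diagonal, Matrix.conjTranspose_apply, bornWeight]
  ring

theorem integral_affine_combination {Ω : Type*} [MeasurableSpace Ω] (μ : Measure Ω)
    [IsProbabilityMeasure μ] {f g : Ω → ℂ} (hf : Integrable f μ) (hg : Integrable g μ)
    (a b c : ℂ) : ∫ t, (a + b * f t + c * g t) ∂μ = a + b * ∫ t, f t ∂μ + c * ∫ t, g t ∂μ := by
  have h : Integrable (fun t => a + b * f t) μ := (integrable_const _).add (hf.const_mul _)
  rw [integral_add h (hg.const_mul _),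
    integral_add (integrable_const _) (hf.const_mul _), integral_const_mul, integral_const_mul]
  simp

theorem integral_trace_Oplus_sq_diagonal {d : ℕ} (hd : d ≠ 0) (x : Fin d → ℂ)
    (hx : ∑ i, x i = 1) :
    ∫ U : UGroup d, (Oplus d ^ 2 * tensorPow 3
        ((U : Matrix (Fin d) (Fin d) ℂ)ᴴ * Matrix.diagonal x * (U : Matrix (Fin d) (Fin d) ℂ))).trace ∂(haarUnitary d) =
      ((d : ℂ) + 2)⁻¹ * (((d : ℂ) - 1) * ((d : ℂ) ^ 2 + 3 * d + 4)
        + 3 * d * ((d : ℂ) - 1) * ((d : ℂ) + 1) * (∑ i, x i ^ 2)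
        + 2 * ((d : ℂ) ^ 3 - (d : ℂ) ^ 2 + 6) * (∑ i, x i ^ 3)) := by
  have htr : ∀ U : UGroup d,
      ((U : Matrix (Fin d) (Fin d) ℂ)ᴴ * Matrix.diagonal x * (U : Matrix (Fin d) (Fin d) ℂ)).trace = 1 := by
    intro U
    rw [Matrix.trace_mul_comm, ← Matrix.mul_assoc]
    have hU : (U : Matrix (Fin d) (Fin d) ℂ) * (U : Matrix (Fin d) (Fin d) ℂ)ᴴ = 1 :=
      Matrix.mem_unitaryGroup_iff.mp U.2
    rw [hU, Matrix.one_mul, Matrix.trace_diagonal, hx]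
  have hc : ∀ n : ℕ, Continuous fun v : Fin d → ℂ => (∑ i, x i * bornWeight v i) ^ n := fun n =>
    (continuous_finsetSum _ fun i _ => continuous_const.mul (continuous_bornWeight i)).pow n
  have hi : ∀ (n : ℕ) (s : Fin d), Integrable (fun U : UGroup d =>
      (∑ i, x i * bornWeight (fun i => (U : Matrix (Fin d) (Fin d) ℂ) i s) i) ^ n)
      (haarUnitary d) := fun n s =>
    integrable_col s (F := fun v => (∑ i, x i * bornWeight v i) ^ n) (hc n)
  simp only [trace_Oplus_sq_mul _ (htr _), conj_diagonal_apply]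
  have h2 : Integrable (fun U : UGroup d => ∑ s : Fin d,
      (∑ i, x i * bornWeight (fun i => (U : Matrix (Fin d) (Fin d) ℂ) i s) i) ^ 2)
      (haarUnitary d) := integrable_finsetSum _ fun s _ => hi 2 s
  have h3 : Integrable (fun U : UGroup d => ∑ s : Fin d,
      (∑ i, x i * bornWeight (fun i => (U : Matrix (Fin d) (Fin d) ℂ) i s) i) ^ 3)
      (haarUnitary d) := integrable_finsetSum _ fun s _ => hi 3 s
  -- All d columns have the same moments, so each sum over s gives a factor d, cancelling the d in
  -- the denominators.
  rw [integral_affine_combination _ h2 h3, integral_finsetSum _ fun s _ => hi 2 s,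
    integral_finsetSum _ fun s _ => hi 3 s]
  have hd0 : (d : ℂ) ≠ 0 := by exact_mod_cast hd
  have hd1 : (d : ℂ) + 1 ≠ 0 := by exact_mod_cast (by omega : d + 1 ≠ 0)
  have hd2 : (d : ℂ) + 2 ≠ 0 := by exact_mod_cast (by omega : d + 2 ≠ 0)
  have m2 : ∀ s : Fin d, ∫ U : UGroup d,
      (∑ i, x i * bornWeight (fun i => (U : Matrix (Fin d) (Fin d) ℂ) i s) i) ^ 2
        ∂(haarUnitary d) = (1 + ∑ i, x i ^ 2) / ((d : ℂ) * (d + 1)) := fun s =>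
    eq_div_of_mul_eq (mul_ne_zero hd0 hd1) (colMean_sq s x hx)
  have m3 : ∀ s : Fin d, ∫ U : UGroup d,
      (∑ i, x i * bornWeight (fun i => (U : Matrix (Fin d) (Fin d) ℂ) i s) i) ^ 3
        ∂(haarUnitary d) =
      (1 + 3 * (∑ i, x i ^ 2) + 2 * ∑ i, x i ^ 3) / ((d : ℂ) * (d + 1) * (d + 2)) := fun s =>
    eq_div_of_mul_eq (mul_ne_zero (mul_ne_zero hd0 hd1) hd2) (colMean_cube s x hx)
  simp only [m2, m3, Finset.sum_const, Finset.card_univ,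
    Fintype.card_fin, nsmul_eq_mul]
  field_simp
  ring

theorem integral_trace_Oplus_sq {d : ℕ} {ρ : Matrix (Fin d) (Fin d) ℂ} (hρ : IsState ρ) :
    ∫ U : UGroup d, (Oplus d ^ 2 * tensorPow 3
        ((U : Matrix (Fin d) (Fin d) ℂ)ᴴ * ρ * (U : Matrix (Fin d) (Fin d) ℂ))).trace ∂(haarUnitary d) =
      ((d : ℂ) + 2)⁻¹ * (((d : ℂ) - 1) * ((d : ℂ) ^ 2 + 3 * d + 4)
        + 3 * d * ((d : ℂ) - 1) * ((d : ℂ) + 1) * (ρ ^ 2).trace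
        + 2 * ((d : ℂ) ^ 3 - (d : ℂ) ^ 2 + 6) * (ρ ^ 3).trace) := by
  -- An empty matrix has trace 0, so a state forces d ≥ 1.
  have hd : d ≠ 0 := by
    rintro rfl
    simpa [Matrix.trace] using hρ.trace_eq_one
  set V : UGroup d := hρ.posSemidef.isHermitian.eigenvectorUnitary
  set x : Fin d → ℂ := RCLike.ofReal ∘ hρ.posSemidef.isHermitian.eigenvalues
  have hspec : ρ = (V : Matrix (Fin d) (Fin d) ℂ) * Matrix.diagonal x *
      (V : Matrix (Fin d) (Fin d) ℂ)ᴴ := by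
    have h := hρ.posSemidef.isHermitian.spectral_theorem
    rwa [Unitary.conjStarAlgAut_apply] at h
  have hV : (V : Matrix (Fin d) (Fin d) ℂ)ᴴ * (V : Matrix (Fin d) (Fin d) ℂ) = 1 :=
    Matrix.mem_unitaryGroup_iff'.mp V.2
  have hpow : ∀ n : ℕ, (ρ ^ n).trace = ∑ i, x i ^ n := by
    intro n
    have h : ρ ^ n = (V : Matrix (Fin d) (Fin d) ℂ) * Matrix.diagonal x ^ n *
        (V : Matrix (Fin d) (Fin d) ℂ)ᴴ := by
      induction n with
      | zero =>
        rw [pow_zero, pow_zero, Matrix.mul_one]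
        exact (Matrix.mem_unitaryGroup_iff.mp V.2).symm
      | succ n ih =>
        rw [pow_succ, ih]
        conv_lhs => rw [hspec]
        rw [pow_succ]
        simp only [Matrix.mul_assoc]
        rw [← Matrix.mul_assoc _ (V : Matrix (Fin d) (Fin d) ℂ), hV, Matrix.one_mul]
    rw [h, Matrix.trace_mul_comm, ← Matrix.mul_assoc, hV, Matrix.one_mul, Matrix.diagonal_pow,
      Matrix.trace_diagonal]
    rfl
  have hx : ∑ i, x i = 1 := by
    have h := hpow 1
    simpa [hρ.trace_eq_one, eq_comm] using h
  -- Substituting VU for U cancels the eigenvector unitary and leaves the diagonal case.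
  rw [hpow, hpow, ← integral_trace_Oplus_sq_diagonal hd x hx,
    ← integral_mul_left_eq_self (fun U : UGroup d => (Oplus d ^ 2 * tensorPow 3
        ((U : Matrix (Fin d) (Fin d) ℂ)ᴴ * ρ * (U : Matrix (Fin d) (Fin d) ℂ))).trace) V]
  refine integral_congr_ae (.of_forall fun U => ?_)
  have hU : ((V * U : UGroup d) : Matrix (Fin d) (Fin d) ℂ)ᴴ * ρ *
      ((V * U : UGroup d) : Matrix (Fin d) (Fin d) ℂ) =
      (U : Matrix (Fin d) (Fin d) ℂ)ᴴ * Matrix.diagonal x * (U : Matrix (Fin d) (Fin d) ℂ) := by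
    have hUV : ((V * U : UGroup d) : Matrix (Fin d) (Fin d) ℂ) =
      (V : Matrix (Fin d) (Fin d) ℂ) * (U : Matrix (Fin d) (Fin d) ℂ) := rfl
    calc _ = (U : Matrix (Fin d) (Fin d) ℂ)ᴴ *
          ((V : Matrix (Fin d) (Fin d) ℂ)ᴴ * (V : Matrix (Fin d) (Fin d) ℂ)) *
          Matrix.diagonal x *
          ((V : Matrix (Fin d) (Fin d) ℂ)ᴴ * (V : Matrix (Fin d) (Fin d) ℂ)) *
          (U : Matrix (Fin d) (Fin d) ℂ) := by
            rw [hUV, Matrix.conjTranspose_mul, hspec]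
            simp only [Matrix.mul_assoc]
      _ = _ := by rw [hV, Matrix.mul_one, Matrix.mul_one]
  simp only [hU]

theorem mainTheorem9 (d : ℕ) (E : Measure (UGroup d)) (hE : IsUnitaryDesign 3 E)
    (ρ : Matrix (Fin d) (Fin d) ℂ) (hρ : IsState ρ) :
    (twirl 3 E (Oplus d ^ 2) * tensorPow 3 ρ).trace =
        ((d : ℂ) + 2)⁻¹ *
          (((d : ℂ) - 1) * ((d : ℂ) ^ 2 + 3 * d + 4)
            + 3 * d * ((d : ℂ) - 1) * ((d : ℂ) + 1) * (ρ ^ 2).trace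
            + 2 * ((d : ℂ) ^ 3 - (d : ℂ) ^ 2 + 6) * (ρ ^ 3).trace) ∧
      (twirlDual 3 E (Oplus d ^ 2) * tensorPow 3 ρ).trace =
        ((d : ℂ) + 2)⁻¹ *
          (((d : ℂ) - 1) * ((d : ℂ) ^ 2 + 3 * d + 4)
            + 3 * d * ((d : ℂ) - 1) * ((d : ℂ) + 1) * (ρ ^ 2).trace
            + 2 * ((d : ℂ) ^ 3 - (d : ℂ) ^ 2 + 6) * (ρ ^ 3).trace) := by
  have := hE.isProbabilityMeasure
  have h : (twirl 3 E (Oplus d ^ 2) * tensorPow 3 ρ).trace =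
      ((d : ℂ) + 2)⁻¹ *
        (((d : ℂ) - 1) * ((d : ℂ) ^ 2 + 3 * d + 4)
          + 3 * d * ((d : ℂ) - 1) * ((d : ℂ) + 1) * (ρ ^ 2).trace
          + 2 * ((d : ℂ) ^ 3 - (d : ℂ) ^ 2 + 6) * (ρ ^ 3).trace) := by
    rw [hE.twirl_eq, trace_twirl_mul_tensorPow, integral_trace_Oplus_sq hρ]
  exact ⟨h, (hE.trace_twirlDual_mul_tensorPow _ ρ).trans h⟩
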